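/- Let $\mathbb F_q$ be a finite field, $m\ge 1$, and let $N,K,D$ be integers with $1<D\le K$. Each of $N$ non-colluding servers stores the same $K$ messages $X_1,\dots,X_K$, which are independent and uniformly distributed over $\mathbb F_q^m$, so that each has $B=m\log_2 q$ bits. The demand index set $\mathbf W$ is uniformly distributed over the $D$-subsets of $[K]$ and independent of the messages. A (scalar-)linear multi-message private information retrieval (MPIR) protocol generates, for each $D$-subset $W$ of $[K]$, random queries $Q_1^{[W]},\dots,Q_N^{[W]}$, whose joint distribution depends only on $W$ and which are independent of the messages. Each query $Q_n^{[W]}$ is a finite list of coefficient vectors in $\mathbb F_q^K$; server $n$ answers with the corresponding $\mathbb F_q$-linear combinations $A_n^{[W]}$ of the messages. The protocol has to satisfy two conditions. - Privacy: for each $n$, every query $c$ that server $n$ receives with positive probability and every $D$-subset $W^*$ of $[K]$, $\mathbb P(\mathbf W=W^*\mid Q_n^{[\mathbf W]}=c)=\mathbb P(\mathbf W=W^*)$. - Recoverability: $(X_i)_{i\in W}$ is determined by the answers, the queries and $W$. The rate of the protocol is $DB$ divided by the expected total number of bits downloaded from the $N$ servers, where each linear combination with nonzero coefficient vector costs $B$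 bits and nothing is sent for a zero coefficient vector. The linear capacity of MPIR is the supremum of the rates of all linear MPIR protocols. **Theorem.** If $D$ divides $K$ and $N=D+1$, then for every finite field $\mathbb F_q$ and every $m\ge1$ the linear capacity of MPIR equals $$C=\frac{1-1/N}{1-1/N^{K/D}}.$$ -/

import Mathlib

open scoped ENNReal

namespace MPIR

noncomputable section

/-- The collection of all possible demand index sets: the `D`-subsets of the set of the `K`
message indices. -/
abbrev Demand (K D : ℕ) : Type := {W : Finset (Fin K) // W.card = D}

/-- The `K` messages; each message is a vector of length `m` over `F`. -/
abbrev Messages (F : Type*) (m K : ℕ) : Type _ := Fin K → Fin m → F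

/-- A query of a (scalar-)linear protocol to one server: the list of the coefficient vectors of the
linear combinations of the messages which the server is asked for. -/
abbrev Query (F : Type*) (K : ℕ) : Type _ := List (Fin K → F)

/-- The linear combination of the messages with coefficient vector `c`. -/
def combination {F : Type*} [Field F] {m K : ℕ} (c : Fin K → F) (X : Messages F m K) : Fin m → F :=
  ∑ i, c i • X i

/-- The answer of a server to the query `Q`: the requested linear combinations of the messages. -/
def answer {F : Type*} [Field F] {m K : ℕ} (Q : Query F K) (X : Messages F m K) :
    List (Fin m → F) :=
  Q.map fun c => combination c X

/-- The size of a message in bits, `B = m log₂ q`. -/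
def messageBits (F : Type*) (m : ℕ) : ℝ := m * Real.logb 2 (Nat.card F)

open Classical in
/-- The number of bits downloaded from a server with query `Q`: each nontrivial linear combination
costs `B` bits, and nothing is sent for a zero coefficient vector. -/
def downloadBits {F : Type*} [Field F] {K : ℕ} (m : ℕ) (Q : Query F K) : ℝ :=
  (Q.filter fun c => c ≠ 0).length * messageBits F m

/-- The probability of an event under a discrete distribution. -/
def prob {Ω : Type*} (p : PMF Ω) (E : Set Ω) : ℝ≥0∞ := p.toOuterMeasure E

/-- The conditional probability of `E` given `G` under a discrete distribution
(meaningful when `prob p G ≠ 0`). -/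
def condProb {Ω : Type*} (p : PMF Ω) (E G : Set Ω) : ℝ≥0∞ := prob p (E ∩ G) / prob p G

/-- The uniform distribution on the set of all demand index sets. -/
def demandPMF {K D : ℕ} (hDK : D ≤ K) : PMF (Demand K D) :=
  haveI : Nonempty (Demand K D) := by
    obtain ⟨W, -, hW⟩ := Finset.exists_subset_card_eq
      (s := (Finset.univ : Finset (Fin K))) (n := D) (by simpa using hDK)
    exact ⟨⟨W, hW⟩⟩
  PMF.uniformOfFintype (Demand K D)

/-- The joint distribution of the uniformly random demand index set `W` and of the tuple of the
queries to the `N` servers, when the queries have distribution `query W` for given `W`. -/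
def jointPMF {F : Type*} {N K D : ℕ} (hDK : D ≤ K)
    (query : Demand K D → PMF (Fin N → Query F K)) : PMF (Demand K D × (Fin N → Query F K)) :=
  (demandPMF hDK).bind fun W => (query W).map fun Q => (W, Q)

/-- A (scalar-)linear MPIR protocol for `N` servers, `K` messages in `F ^ m` and demand's size `D`.
The queries are a stochastic function of the demand index set alone, so they are independent of the
messages; over a finite field there are only countably many tuples of queries, so that a discrete
distribution is the general case. -/
structure LinearProtocol (F : Type*) [Field F] (m N K D : ℕ) (hDK : D ≤ K) where
  /-- The joint distribution of the queries to the `N` servers, for every demand index set. -/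
  query : Demand K D → PMF (Fin N → Query F K)
  /-- Privacy: given the query that server `n` receives, the demand index set still has its
  a priori distribution. -/
  privacy : ∀ (n : Fin N) (c : Query F K),
    prob (jointPMF hDK query) {ω | ω.2 n = c} ≠ 0 →
    ∀ W' : Demand K D,
      condProb (jointPMF hDK query) {ω | ω.1 = W'} {ω | ω.2 n = c} =
        prob (jointPMF hDK query) {ω | ω.1 = W'}
  /-- Recoverability: the demanded messages are a function of the answers, the queries and the
  demand index set. -/
  recoverability : ∀ W : Demand K D,
    ∃ decode : (Fin N → List (Fin m → F)) → (Fin N → Query F K) → (W.1 → Fin m → F),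
      ∀ Q ∈ (query W).support, ∀ X : Messages F m K,
        decode (fun n => answer (Q n) X) Q = fun i => X i.1

variable {F : Type*} [Field F] {m N K D : ℕ} {hDK : D ≤ K}

/-- The expected number of bits downloaded from all servers. -/
def LinearProtocol.expectedDownload (P : LinearProtocol F m N K D hDK) : ℝ≥0∞ :=
  ∑ n : Fin N, ∑' ω, jointPMF hDK P.query ω * ENNReal.ofReal (downloadBits m (ω.2 n))

/-- The rate of a protocol: the number `D * B` of bits required by the user divided by the expected
number of bits downloaded from all servers. -/
def LinearProtocol.rate (P : LinearProtocol F m N K D hDK) : ℝ≥0∞ :=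
  ENNReal.ofReal (D * messageBits F m) / P.expectedDownload

/-- The linear capacity of MPIR: the supremum of the rates of all linear protocols. -/
def linearCapacity (F : Type*) [Field F] (m N K D : ℕ) (hDK : D ≤ K) : ℝ≥0∞ :=
  ⨆ P : LinearProtocol F m N K D hDK, P.rate

end

end MPIR

namespace MPIR

section Privacy

variable {F : Type*} {N K D : ℕ} {hDK : D ≤ K}

/-- The distribution of the query to server `n`, for a uniformly random demand. -/
noncomputable def queryMarginal (hDK : D ≤ K) (query : Demand K D → PMF (Fin N → Query F K))
    (n : Fin N) : PMF (Query F K) :=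
  (jointPMF hDK query).map fun ω => ω.2 n

lemma demandPMF_apply (W : Demand K D) :
    demandPMF hDK W = (Fintype.card (Demand K D) : ℝ≥0∞)⁻¹ := by
  simp [demandPMF]

lemma demandPMF_ne_zero (W : Demand K D) : demandPMF hDK W ≠ 0 := by
  simp [demandPMF_apply]

lemma prob_fst (query : Demand K D → PMF (Fin N → Query F K)) (W : Demand K D) :
    prob (jointPMF hDK query) {ω | ω.1 = W} = demandPMF hDK W := by
  have h : (jointPMF hDK query).map Prod.fst = demandPMF hDK := by
    simp only [jointPMF, PMF.map_bind, PMF.map_comp, Function.comp_def]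
    exact (congrArg _ (funext fun W => PMF.map_const _ W)).trans (PMF.bind_pure _)
  rw [← h, ← PMF.toOuterMeasure_apply_singleton, PMF.toOuterMeasure_map_apply]
  rfl

lemma prob_snd (query : Demand K D → PMF (Fin N → Query F K)) (n : Fin N) (c : Query F K) :
    prob (jointPMF hDK query) {ω | ω.2 n = c} = queryMarginal hDK query n c := by
  rw [queryMarginal, ← PMF.toOuterMeasure_apply_singleton, PMF.toOuterMeasure_map_apply]
  rfl

lemma prob_inter (query : Demand K D → PMF (Fin N → Query F K)) (n : Fin N) (c : Query F K)
    (W : Demand K D) :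
    prob (jointPMF hDK query) ({ω | ω.1 = W} ∩ {ω | ω.2 n = c}) =
      demandPMF hDK W * (query W).map (fun Q => Q n) c := by
  rw [prob, jointPMF, PMF.toOuterMeasure_bind_apply, tsum_eq_single W]
  · congr 1
    rw [PMF.toOuterMeasure_map_apply, ← PMF.toOuterMeasure_apply_singleton,
      PMF.toOuterMeasure_map_apply]
    congr 1
    ext Q
    simp
  · intro W' hW'
    rw [PMF.toOuterMeasure_map_apply]
    have : (fun Q : Fin N → Query F K => (W', Q)) ⁻¹' ({ω | ω.1 = W} ∩ {ω | ω.2 n = c}) = ∅ := by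
      ext Q
      simp [hW']
    rw [this]
    simp

lemma queryMarginal_eq_bind (query : Demand K D → PMF (Fin N → Query F K)) (n : Fin N) :
    queryMarginal hDK query n = (demandPMF hDK).bind fun W => (query W).map fun Q => Q n := by
  simp [queryMarginal, jointPMF, PMF.map_bind, PMF.map_comp, Function.comp_def]

/-- Under privacy, the query to a server has the same distribution for all demands. -/
lemma map_query_eq_queryMarginal {query : Demand K D → PMF (Fin N → Query F K)}
    (h : ∀ (n : Fin N) (c : Query F K),
      prob (jointPMF hDK query) {ω | ω.2 n = c} ≠ 0 →
      ∀ W' : Demand K D,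
        condProb (jointPMF hDK query) {ω | ω.1 = W'} {ω | ω.2 n = c} =
          prob (jointPMF hDK query) {ω | ω.1 = W'})
    (n : Fin N) (W : Demand K D) :
    (query W).map (fun Q => Q n) = queryMarginal hDK query n := by
  ext c
  by_cases hc : queryMarginal hDK query n c = 0
  · rw [hc]
    rw [queryMarginal_eq_bind, PMF.bind_apply, ENNReal.tsum_eq_zero] at hc
    simpa [demandPMF_ne_zero] using hc W
  · have := h n c (by rwa [prob_snd]) W
    rw [condProb, prob_fst, prob_inter, prob_snd, mul_div_assoc] at this
    have h2 : (query W).map (fun Q => Q n) c / queryMarginal hDK query n c = 1 := by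
      have h0 := demandPMF_ne_zero (hDK := hDK) W
      have ht := PMF.apply_ne_top (demandPMF hDK) W
      exact (ENNReal.mul_right_inj h0 ht).1 (by rw [this, mul_one])
    rwa [ENNReal.div_eq_one_iff hc (PMF.apply_ne_top _ _)] at h2

/-- Privacy holds if the query to a server has the same distribution for all demands. -/
lemma condProb_eq_of_map_query_eq {query : Demand K D → PMF (Fin N → Query F K)}
    {μ : Fin N → PMF (Query F K)} (h : ∀ n W, (query W).map (fun Q => Q n) = μ n)
    (n : Fin N) (c : Query F K)
    (hc : prob (jointPMF hDK query) {ω | ω.2 n = c} ≠ 0) (W : Demand K D) :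
    condProb (jointPMF hDK query) {ω | ω.1 = W} {ω | ω.2 n = c} =
      prob (jointPMF hDK query) {ω | ω.1 = W} := by
  have hm : queryMarginal hDK query n = μ n := by
    simp [queryMarginal_eq_bind, h]
  rw [prob_snd] at hc
  rw [condProb, prob_fst, prob_inter, prob_snd, mul_div_assoc, h, ← hm,
    ENNReal.div_self hc (PMF.apply_ne_top _ _), mul_one]

lemma tsum_map_mul {α β : Type*} (p : PMF α) (f : α → β) (g : β → ℝ≥0∞) :
    ∑' b, p.map f b * g b = ∑' a, p a * g (f a) := by
  simp_rw [PMF.map_apply, ← ENNReal.tsum_mul_right]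
  rw [ENNReal.tsum_comm]
  refine tsum_congr fun a => ?_
  rw [tsum_eq_single (f a)]
  · simp
  · intro b hb
    simp [hb]

lemma LinearProtocol.expectedDownload_eq {F : Type*} [Field F] {m : ℕ}
    (P : LinearProtocol F m N K D hDK) :
    P.expectedDownload = ∑ n : Fin N, ∑' c, queryMarginal hDK P.query n c *
      ENNReal.ofReal (downloadBits m c) := by
  simp_rw [expectedDownload, queryMarginal, tsum_map_mul]

end Privacy

section Rank

variable {F ι : Type*} [Field F] [Fintype ι] [DecidableEq ι]

/-- The linear map that replaces the coordinates in `S` by zero. -/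
def eraseCoords (F : Type*) [Field F] {ι : Type*} [DecidableEq ι] (S : Finset ι) :
    (ι → F) →ₗ[F] (ι → F) :=
  LinearMap.pi fun i => if i ∈ S then 0 else LinearMap.proj i

lemma eraseCoords_apply {F ι : Type*} [Field F] [DecidableEq ι] (S : Finset ι) (v : ι → F) (i : ι) :
    eraseCoords F S v i = if i ∈ S then 0 else v i := by
  by_cases h : i ∈ S <;> simp [eraseCoords, h]

/-- The dimension of a subspace of `F ^ ι` modulo the coordinates in `S`. -/
noncomputable def rankMod (S : Finset ι) (V : Submodule F (ι → F)) : ℕ :=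
  Module.finrank F (V.map (eraseCoords F S))

lemma rankMod_mono (S : Finset ι) {V V' : Submodule F (ι → F)} (h : V ≤ V') :
    rankMod S V ≤ rankMod S V' :=
  Submodule.finrank_mono (Submodule.map_mono h)

lemma rankMod_iSup_le {κ : Type*} [Fintype κ] (S : Finset ι) (V : κ → Submodule F (ι → F)) :
    rankMod S (⨆ n, V n) ≤ ∑ n, rankMod S (V n) := by
  classical
  have key : ∀ t : Finset κ, rankMod S (t.sup V) ≤ ∑ n ∈ t, rankMod S (V n) := by
    intro t
    induction t using Finset.induction_on with
    | empty => simp [rankMod]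
    | insert a t ha ih =>
      rw [Finset.sup_insert, Finset.sum_insert ha]
      refine le_trans ?_ (Nat.add_le_add_left ih _)
      rw [rankMod, Submodule.map_sup]
      exact Submodule.finrank_add_le_finrank_add_finrank _ _
  simpa [Finset.sup_univ_eq_iSup] using key Finset.univ

lemma rankMod_le_finrank (S : Finset ι) (V : Submodule F (ι → F)) :
    rankMod S V ≤ Module.finrank F V :=
  Submodule.finrank_map_le _ _

lemma card_add_rankMod_union_le {S W : Finset ι} (hSW : Disjoint W S)
    {V : Submodule F (ι → F)} (hV : ∀ i ∈ W, Pi.single i 1 ∈ V) :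
    W.card + rankMod (S ∪ W) V ≤ rankMod S V := by
  set V₁ := V.map (eraseCoords F S)
  set V₂ := V.map (eraseCoords F (S ∪ W))
  set E := Submodule.span F (Set.range fun i : W => (Pi.single (i : ι) 1 : ι → F))
  have hsingle : ∀ i ∈ W, (Pi.single i 1 : ι → F) ∈ V₁ := by
    intro i hi
    refine ⟨_, hV i hi, ?_⟩
    ext j
    rw [eraseCoords_apply]
    split_ifs with hj
    · have : j ≠ i := by
        rintro rfl
        exact Finset.disjoint_left.1 hSW hi hj
      simp [this]
    · rfl
  have hE : Module.finrank F E = W.card := by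
    have hli : LinearIndependent F fun i : W => (Pi.single (i : ι) 1 : ι → F) := by
      have := (Pi.basisFun F ι).linearIndependent.comp (fun i : W => (i : ι))
        Subtype.val_injective
      simpa [Function.comp_def] using this
    rw [finrank_span_eq_card hli, Fintype.card_coe]
  have hE₁ : E ≤ V₁ := by
    rw [Submodule.span_le]
    rintro _ ⟨i, rfl⟩
    exact hsingle i i.2
  have h₂₁ : V₂ ≤ V₁ := by
    rintro _ ⟨v, hv, rfl⟩
    have : eraseCoords F (S ∪ W) v =
        eraseCoords F S v - ∑ i ∈ W, (eraseCoords F S v i) • (Pi.single i 1 : ι → F) := by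
      ext j
      simp only [eraseCoords_apply, Finset.mem_union, Pi.sub_apply, Finset.sum_apply,
        Pi.smul_apply, Pi.single_apply, smul_eq_mul, mul_ite, mul_one, mul_zero,
        Finset.sum_ite_eq]
      by_cases h1 : j ∈ S <;> by_cases h2 : j ∈ W <;> simp [h1, h2]
    rw [this]
    exact Submodule.sub_mem _ ⟨v, hv, rfl⟩
      (Submodule.sum_mem _ fun i hi => Submodule.smul_mem _ _ (hsingle i hi))
  have hdisj : E ⊓ V₂ = ⊥ := by
    rw [Submodule.eq_bot_iff]
    rintro x ⟨hx, v, -, rfl⟩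
    have hoff : ∀ y ∈ E, ∀ j, j ∉ W → y j = 0 := by
      intro y hy j hj
      have : E ≤ LinearMap.ker (LinearMap.proj j : (ι → F) →ₗ[F] F) := by
        rw [Submodule.span_le]
        rintro _ ⟨i, rfl⟩
        have : j ≠ i := by
          rintro rfl
          exact hj i.2
        simp [this]
      exact this hy
    ext j
    by_cases hj : j ∈ W
    · simp [eraseCoords_apply, hj]
    · exact hoff _ hx j hj
  have hsum := Submodule.finrank_sup_add_finrank_inf_eq E V₂
  rw [hdisj, finrank_bot, add_zero, hE] at hsum
  rw [rankMod, rankMod, ← hsum]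
  exact Submodule.finrank_mono (sup_le hE₁ h₂₁)

end Rank

section QuerySpan

variable {F : Type*} [Field F] {m N K D : ℕ} {hDK : D ≤ K}

/-- The span of the coefficient vectors of a query. -/
def querySpan (Q : Query F K) : Submodule F (Fin K → F) := Submodule.span F {c | c ∈ Q}

lemma messageBits_nonneg (F : Type*) (m : ℕ) : 0 ≤ messageBits F m := by
  unfold messageBits
  refine mul_nonneg (Nat.cast_nonneg _) ?_
  rcases Nat.eq_zero_or_pos (Nat.card F) with h | h
  · simp [h]
  · exact Real.logb_nonneg one_lt_two (by exact_mod_cast h)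

lemma finrank_querySpan_mul_le (m : ℕ) (Q : Query F K) :
    Module.finrank F (querySpan Q) * messageBits F m ≤ downloadBits m Q := by
  classical
  unfold downloadBits
  refine mul_le_mul_of_nonneg_right ?_ (messageBits_nonneg F m)
  have h : querySpan Q = Submodule.span F ((Q.filter fun c => c ≠ 0).toFinset : Set _) := by
    rw [querySpan, ← Submodule.span_sdiff_singleton_zero]
    congr 1
    ext c
    simp
  rw [h]
  refine Nat.cast_le.2 ((finrank_span_finset_le_card _).trans ?_)
  convert List.toFinset_card_le _

/-- Equal answers to the queries give equal combinations for all coefficient vectors in their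
span. -/
lemma combination_eq_of_mem_span {Q : Fin N → Query F K} {X Y : Messages F m K}
    (h : ∀ n, answer (Q n) X = answer (Q n) Y) {c : Fin K → F}
    (hc : c ∈ ⨆ n, querySpan (Q n)) : combination c X = combination c Y := by
  let φ : (Fin K → F) →ₗ[F] (Fin m → F) := Fintype.linearCombination F (X - Y)
  have hφ : ∀ c, φ c = combination c X - combination c Y := by
    intro c
    simp [φ, Fintype.linearCombination_apply, combination, smul_sub]
  have hle : ⨆ n, querySpan (Q n) ≤ LinearMap.ker φ := by
    refine iSup_le fun n => Submodule.span_le.2 fun c hc => ?_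
    rw [SetLike.mem_coe, LinearMap.mem_ker, hφ, sub_eq_zero]
    exact List.map_inj_left.1 (h n) c hc
  have := hle hc
  rwa [LinearMap.mem_ker, hφ, sub_eq_zero] at this

lemma combination_single (i : Fin K) (X : Messages F m K) :
    combination (Pi.single i 1) X = X i := by
  simp [combination, Pi.single_apply, ite_smul]

/-- Recoverable messages have their unit vectors in the span of the queries. -/
lemma LinearProtocol.single_mem_iSup (hm : 1 ≤ m) (P : LinearProtocol F m N K D hDK)
    (W : Demand K D) {Q : Fin N → Query F K} (hQ : Q ∈ (P.query W).support) {i : Fin K}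
    (hi : i ∈ W.1) : Pi.single i 1 ∈ ⨆ n, querySpan (Q n) := by
  by_contra hnot
  obtain ⟨f, hf, hfV⟩ := Submodule.exists_le_ker_of_notMem hnot
  obtain ⟨decode, hdec⟩ := P.recoverability W
  let X : Messages F m K := fun j _ => f (Pi.single j 1)
  have hcomb : ∀ c, combination c X = fun _ => f c := by
    intro c
    ext k
    conv_rhs => rw [← Finset.univ_sum_single c, map_sum]
    simp only [combination, Finset.sum_apply, Pi.smul_apply, X]
    refine Finset.sum_congr rfl fun j _ => ?_
    rw [← map_smul, ← Pi.single_smul]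
    simp
  have hans : (fun n => answer (Q n) X) = fun n => answer (Q n) (0 : Messages F m K) := by
    ext1 n
    refine List.map_congr_left fun c hc => ?_
    have h0 : f c = 0 := hfV (Submodule.mem_iSup_of_mem n (Submodule.subset_span hc))
    rw [hcomb, h0]
    simp [combination]
    rfl
  have h1 := hdec Q hQ X
  rw [hans, hdec Q hQ 0] at h1
  have h2 := congrFun (congrFun h1 ⟨i, hi⟩) ⟨0, hm⟩
  exact hf (by simpa [X] using h2.symm)

end QuerySpan

section Converse

variable {F : Type*} [Field F] {m N K D : ℕ} {hDK : D ≤ K}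

/-- The expected total dimension of the queries modulo the messages in `S`. -/
noncomputable def LinearProtocol.expectedRank (P : LinearProtocol F m N K D hDK)
    (S : Finset (Fin K)) : ℝ≥0∞ :=
  ∑ n : Fin N, ∑' c, queryMarginal hDK P.query n c * (rankMod S (querySpan c) : ℝ≥0∞)

lemma LinearProtocol.expectedRank_eq (P : LinearProtocol F m N K D hDK)
    (S : Finset (Fin K)) (W : Demand K D) :
    P.expectedRank S =
      ∑' Q, P.query W Q * ((∑ n, rankMod S (querySpan (Q n)) : ℕ) : ℝ≥0∞) := by
  simp_rw [expectedRank, ← map_query_eq_queryMarginal P.privacy _ W, tsum_map_mul]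
  rw [← Summable.tsum_finsetSum fun _ _ => ENNReal.summable]
  push_cast
  simp_rw [Finset.mul_sum]

lemma LinearProtocol.add_expectedRank_union_le (hm : 1 ≤ m) (P : LinearProtocol F m N K D hDK)
    {S : Finset (Fin K)} (W : Demand K D) (hSW : Disjoint W.1 S) :
    D + (N : ℝ≥0∞)⁻¹ * P.expectedRank (S ∪ W.1) ≤ P.expectedRank S := by
  rw [P.expectedRank_eq S W, P.expectedRank_eq _ W, ← ENNReal.tsum_mul_left]
  have hD : (D : ℝ≥0∞) = ∑' Q, P.query W Q * D := by
    rw [ENNReal.tsum_mul_right, PMF.tsum_coe, one_mul]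
  rw [hD, ← ENNReal.tsum_add]
  refine ENNReal.tsum_le_tsum fun Q => ?_
  by_cases hQ : P.query W Q = 0
  · simp [hQ]
  rw [mul_left_comm, ← mul_add]
  refine mul_le_mul_right ?_ _
  have h1 : D + rankMod (S ∪ W.1) (⨆ n, querySpan (Q n)) ≤
      ∑ n, rankMod S (querySpan (Q n)) := by
    refine le_trans ?_ (rankMod_iSup_le S _)
    have := card_add_rankMod_union_le hSW (V := ⨆ n, querySpan (Q n))
      fun i hi => P.single_mem_iSup hm W ((PMF.mem_support_iff _ _).2 hQ) hi
    rwa [W.2] at this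
  have h2 : ∑ n, rankMod (S ∪ W.1) (querySpan (Q n)) ≤
      N * rankMod (S ∪ W.1) (⨆ n, querySpan (Q n)) := by
    refine (Finset.sum_le_card_nsmul Finset.univ _
      (rankMod (S ∪ W.1) (⨆ n, querySpan (Q n))) fun n _ => rankMod_mono _ ?_).trans ?_
    · exact le_iSup (fun n => querySpan (Q n)) n
    · simp
  refine le_trans ?_ (Nat.cast_le.2 h1)
  rw [Nat.cast_add]
  refine add_le_add_right ?_ _
  rw [mul_comm, ← div_eq_mul_inv]
  refine ENNReal.div_le_of_le_mul' ?_
  exact_mod_cast h2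

lemma LinearProtocol.geom_le_expectedRank (hm : 1 ≤ m) (P : LinearProtocol F m N K D hDK)
    (l : ℕ) (S : Finset (Fin K)) (hS : S.card + D * l = K) :
    D * ∑ k ∈ Finset.range l, ((N : ℝ≥0∞)⁻¹) ^ k ≤ P.expectedRank S := by
  induction l generalizing S with
  | zero => simp
  | succ l ih =>
    have hc : D ≤ Sᶜ.card := by
      rw [Finset.card_compl, Fintype.card_fin]
      rw [mul_add] at hS
      omega
    obtain ⟨W, hW, hWD⟩ := Finset.exists_subset_card_eq hc
    have hdisj : Disjoint W S := Finset.subset_compl_iff_disjoint_right.1 hW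
    refine le_trans ?_ (P.add_expectedRank_union_le hm ⟨W, hWD⟩ hdisj)
    have := ih (S ∪ W) (by
      rw [Finset.card_union_of_disjoint hdisj.symm, hWD]
      rw [mul_add] at hS
      omega)
    rw [Finset.sum_range_succ']
    simp only [pow_succ', ← Finset.mul_sum, pow_zero]
    rw [mul_add, mul_one, add_comm, mul_left_comm]
    exact add_le_add_right (mul_le_mul_right this _) _

lemma LinearProtocol.expectedRank_mul_le (P : LinearProtocol F m N K D hDK) :
    P.expectedRank ∅ * ENNReal.ofReal (messageBits F m) ≤ P.expectedDownload := by
  rw [P.expectedDownload_eq, expectedRank, Finset.sum_mul]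
  refine Finset.sum_le_sum fun n _ => ?_
  rw [← ENNReal.tsum_mul_right]
  refine ENNReal.tsum_le_tsum fun c => ?_
  rw [mul_assoc]
  refine mul_le_mul_right ?_ _
  rw [← ENNReal.ofReal_natCast, ← ENNReal.ofReal_mul (Nat.cast_nonneg _)]
  refine ENNReal.ofReal_le_ofReal (le_trans ?_ (finrank_querySpan_mul_le m c))
  refine mul_le_mul_of_nonneg_right (Nat.cast_le.2 (rankMod_le_finrank _ _))
    (messageBits_nonneg F m)

end Converse

section Numbers

lemma exists_root {D : ℕ} (hD : D ≠ 0) : ∃ x : ℝ, 0 ≤ x ∧ (1 + x) ^ D = D + 1 := by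
  have h1 : (1 : ℝ) ≤ D + 1 := by simp
  refine ⟨((D : ℝ) + 1) ^ (D : ℝ)⁻¹ - 1, ?_, ?_⟩
  · exact sub_nonneg.2 (Real.one_le_rpow h1 (by positivity))
  · rw [add_sub_cancel, Real.rpow_inv_natCast_pow (by positivity) hD]

/-- The terms of the binomial expansion of `(1 + x) ^ D` cannot return above `1`. -/
lemma choose_mul_pow_succ_lt_one {D : ℕ} {x : ℝ} (hx : 0 ≤ x) {s : ℕ}
    (hs : D.choose s * x ^ s < 1) : D.choose (s + 1) * x ^ (s + 1) < 1 := by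
  by_contra! hcon
  have hstep : ∀ j, ((D.choose (j + 1) : ℝ) * x ^ (j + 1)) * (j + 1) =
      (D.choose j * x ^ j) * (((D - j : ℕ) : ℝ) * x) := by
    intro j
    have h : (D.choose (j + 1) : ℝ) * (j + 1) = D.choose j * ((D - j : ℕ) : ℝ) := by
      exact_mod_cast Nat.choose_succ_right_eq D j
    rw [pow_succ]
    linear_combination x ^ j * x * h
  have hratio : (s : ℝ) + 1 ≤ ((D - s : ℕ) : ℝ) * x := by
    have h := hstep s
    have h0 : (0 : ℝ) ≤ ((D - s : ℕ) : ℝ) * x := by positivity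
    have hs0 : (0 : ℝ) < s + 1 := by positivity
    nlinarith
  have hinc : ∀ j ≤ s, 1 ≤ (D.choose j : ℝ) * x ^ j := by
    intro j
    induction j with
    | zero => simp
    | succ j ih =>
      intro hj
      have ih := ih (by omega)
      have h1 : (j : ℝ) + 1 ≤ ((D - j : ℕ) : ℝ) * x := by
        refine le_trans ?_ (hratio.trans ?_)
        · have : (j : ℝ) ≤ s := by exact_mod_cast (by omega : j ≤ s)
          linarith
        · gcongr
          omega
      have h2 := hstep j
      have h3 : (0 : ℝ) < j + 1 := by positivity
      by_contra! h4
      nlinarith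
  exact absurd (hinc s le_rfl) (not_le.2 hs)

/-- The partial sums of `(1 + x) ^ D - 1 = D` grow at least linearly. -/
lemma le_sum_choose_mul_pow {D : ℕ} {x : ℝ} (hx : 0 ≤ x) (hxD : (1 + x) ^ D = D + 1) {s : ℕ}
    (hs : s ≤ D) : (s : ℝ) ≤ ∑ j ∈ Finset.range s, D.choose (j + 1) * x ^ (j + 1) := by
  by_cases hall : ∀ j < s, 1 ≤ (D.choose (j + 1) : ℝ) * x ^ (j + 1)
  · calc (s : ℝ) = ∑ j ∈ Finset.range s, 1 := by simp
      _ ≤ _ := Finset.sum_le_sum fun j hj => hall j (Finset.mem_range.1 hj)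
  · push Not at hall
    obtain ⟨j, hj, hlt⟩ := hall
    have hlater : ∀ k, j + 1 ≤ k → (D.choose k : ℝ) * x ^ k < 1 := by
      intro k hk
      induction k, hk using Nat.le_induction with
      | base => exact hlt
      | succ k _ ih => exact choose_mul_pow_succ_lt_one hx ih
    have htot : ∑ j ∈ Finset.range D, (D.choose (j + 1) : ℝ) * x ^ (j + 1) = D := by
      rw [add_comm, add_pow, Finset.sum_range_succ'] at hxD
      simp only [one_pow, mul_one, pow_zero, Nat.choose_zero_right, Nat.cast_one] at hxD
      simp_rw [mul_comm (_ : ℝ) (x ^ _)]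
      linarith
    rw [← Finset.sum_range_add_sum_Ico _ hs] at htot
    have hrest : ∑ j ∈ Finset.Ico s D, (D.choose (j + 1) : ℝ) * x ^ (j + 1) ≤ D - s := by
      calc _ ≤ ∑ j ∈ Finset.Ico s D, (1 : ℝ) :=
            Finset.sum_le_sum fun k hk => (hlater _ (by
              have := Finset.mem_Ico.1 hk
              omega)).le
        _ = D - s := by
            simp [Nat.cast_sub hs]
    linarith

lemma min_succ_sub_min_mono {a C C' : ℝ} (h : C ≤ C') :
    min (a + 1) C - min a C ≤ min (a + 1) C' - min a C' := by
  rcases le_total a C with h1 | h1 <;> rcases le_total (a + 1) C with h2 | h2 <;>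
  rcases le_total a C' with h3 | h3 <;> rcases le_total (a + 1) C' with h4 | h4 <;>
  simp only [min_eq_left, min_eq_right, h1, h2, h3, h4] <;> linarith

/-- A lower triangular stochastic matrix with the binomial terms as its column sums. -/
lemma exists_triangular_stochastic {D : ℕ} {x : ℝ} (hx : 0 ≤ x) (hxD : (1 + x) ^ D = D + 1) :
    ∃ μ : Fin D → PMF (Fin D), (∀ i s, i < s → μ i s = 0) ∧
      ∀ s, ∑ i, μ i s = D.choose (s + 1) * ENNReal.ofReal x ^ (s.1 + 1) := by
  set C : ℕ → ℝ := fun s => ∑ j ∈ Finset.range s, D.choose (j + 1) * x ^ (j + 1)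
  have hC : ∀ s ≤ D, (s : ℝ) ≤ C s := fun s hs => le_sum_choose_mul_pow hx hxD hs
  have hCD : C D = D := by
    rw [add_comm, add_pow, Finset.sum_range_succ'] at hxD
    simp only [one_pow, mul_one, pow_zero, Nat.choose_zero_right, Nat.cast_one] at hxD
    simp_rw [C, mul_comm (_ : ℝ) (x ^ _)]
    linarith
  have hCmono : Monotone C := by
    refine monotone_nat_of_le_succ fun s => ?_
    simp only [C, Finset.sum_range_succ]
    have : 0 ≤ (D.choose (s + 1) : ℝ) * x ^ (s + 1) := by positivity
    linarith
  let lam : ℕ → ℕ → ℝ := fun i s =>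
    (min ((i : ℝ) + 1) (C (s + 1)) - min (i : ℝ) (C (s + 1))) -
      (min ((i : ℝ) + 1) (C s) - min (i : ℝ) (C s))
  have hnn : ∀ i s, 0 ≤ lam i s := fun i s =>
    sub_nonneg.2 (min_succ_sub_min_mono (hCmono s.le_succ))
  have hrow : ∀ i < D, ∑ s : Fin D, lam i s = 1 := by
    intro i hi
    rw [Fin.sum_univ_eq_sum_range (fun s => lam i s),
      Finset.sum_range_sub (fun s => min ((i : ℝ) + 1) (C s) - min (i : ℝ) (C s))]
    have h1 : (i : ℝ) + 1 ≤ D := by exact_mod_cast hi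
    have h0 : (0 : ℝ) ≤ i := by positivity
    have hC0 : C 0 = 0 := by simp [C]
    rw [hCD, hC0, min_eq_left h1, min_eq_left (by linarith), min_eq_right (by linarith),
      min_eq_right h0]
    ring
  have hcol : ∀ s < D, ∑ i : Fin D, lam i s = D.choose (s + 1) * x ^ (s + 1) := by
    intro s hs
    rw [Fin.sum_univ_eq_sum_range (fun i => lam i s)]
    have htel : ∀ c : ℝ, 0 ≤ c → c ≤ D →
        ∑ i ∈ Finset.range D, (min ((i : ℝ) + 1) c - min (i : ℝ) c) = c := by
      intro c hc hcD
      have := Finset.sum_range_sub (fun i : ℕ => min (i : ℝ) c) D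
      push_cast at this
      rw [this, min_eq_right hcD, min_eq_left hc, sub_zero]
    have hpos : ∀ s, 0 ≤ C s := fun s => by positivity
    simp only [lam]
    rw [Finset.sum_sub_distrib, htel _ (hpos _) (hCD ▸ hCmono hs),
      htel _ (hpos _) (hCD ▸ hCmono hs.le)]
    simp [C, Finset.sum_range_succ]
  refine ⟨fun i => PMF.ofFintype (fun s => ENNReal.ofReal (lam i s)) ?_, ?_, ?_⟩
  · rw [← ENNReal.ofReal_sum_of_nonneg fun s _ => hnn _ _, hrow i i.2, ENNReal.ofReal_one]
  · intro i s his
    have h1 : (i : ℝ) + 1 ≤ s := by exact_mod_cast his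
    have h2 := hC s s.2.le
    have h3 := hC (s + 1) s.2
    push_cast at h3
    rw [PMF.ofFintype_apply, ENNReal.ofReal_eq_zero]
    simp only [lam]
    rw [min_eq_left (by linarith), min_eq_left (by linarith), min_eq_left (by linarith),
      min_eq_left (by linarith)]
    simp
  · intro s
    simp only [PMF.ofFintype_apply]
    rw [← ENNReal.ofReal_sum_of_nonneg fun s _ => hnn _ _, hcol s s.2,
      ENNReal.ofReal_mul (Nat.cast_nonneg _), ENNReal.ofReal_natCast, ENNReal.ofReal_pow hx]

end Numbers

section Distributions

lemma sum_coe {α : Type*} [Fintype α] (p : PMF α) : ∑ a, p a = 1 := by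
  rw [← p.tsum_coe, tsum_fintype]

/-- Distributions have a (the independent) coupling. -/
lemma exists_coupling {ι α : Type*} [Fintype ι] [Fintype α] (μ : ι → PMF α) :
    ∃ ν : PMF (ι → α), ∀ i, ν.map (fun g => g i) = μ i := by
  classical
  refine ⟨PMF.ofFintype (fun g => ∏ i, μ i (g i)) ?_, fun i => ?_⟩
  · rw [← Fintype.prod_sum]
    refine Finset.prod_eq_one fun i _ => ?_
    exact sum_coe _
  · ext a
    rw [PMF.map_apply, tsum_fintype]
    let f : ι → α → ℝ≥0∞ := fun j b => if j = i then (if a = b then μ j b else 0) else μ j b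
    have h : ∀ g : ι → α, (if a = g i then ∏ j, μ j (g j) else 0) = ∏ j, f j (g j) := by
      intro g
      by_cases hg : a = g i
      · rw [if_pos hg]
        refine Finset.prod_congr rfl fun j _ => ?_
        by_cases hj : j = i
        · subst hj
          simp [f, hg]
        · simp [f, hj]
      · rw [if_neg hg, Finset.prod_eq_zero (Finset.mem_univ i)]
        simp [f, hg]
    simp only [PMF.ofFintype_apply, h]
    rw [← Fintype.prod_sum, Finset.prod_eq_single i]
    · simp [f]
    · intro j _ hj
      simp only [f, if_neg hj]
      exact sum_coe _
    · simp

lemma exists_perm_map_eq {α : Type*} [Fintype α] [DecidableEq α] {S T : Finset α}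
    (h : S.card = T.card) : ∃ σ : Equiv.Perm α, S.map σ.toEmbedding = T := by
  let e : {a // a ∈ S} ≃ {a // a ∈ T} := Fintype.equivOfCardEq (by simpa using h)
  refine ⟨e.extendSubtype, Finset.eq_of_subset_of_card_le ?_ (by simp [h])⟩
  intro a ha
  obtain ⟨b, hb, rfl⟩ := Finset.mem_map.1 ha
  exact e.extendSubtype_mem b hb

/-- A random permutation maps a set to a random set of the same size. -/
lemma map_uniform_perm_apply {D : ℕ} (A T : Finset (Fin D)) :
    (PMF.uniformOfFintype (Equiv.Perm (Fin D))).map (fun π => A.map π.toEmbedding) T =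
      if T.card = A.card then (D.choose A.card : ℝ≥0∞)⁻¹ else 0 := by
  set p := (PMF.uniformOfFintype (Equiv.Perm (Fin D))).map (fun π => A.map π.toEmbedding)
  have hinv : ∀ (σ : Equiv.Perm (Fin D)) (T : Finset (Fin D)),
      p (T.map σ.toEmbedding) = p T := by
    intro σ T
    simp only [p, PMF.map_apply, tsum_fintype, PMF.uniformOfFintype_apply]
    rw [← Equiv.sum_comp (Equiv.mulLeft σ)]
    refine Finset.sum_congr rfl fun π _ => ?_
    have : A.map (Equiv.mulLeft σ π).toEmbedding =
        (A.map π.toEmbedding).map σ.toEmbedding := by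
      rw [Finset.map_map]
      rfl
    rw [this]
    simp only [Finset.map_inj]
  have hsupp : ∀ T : Finset (Fin D), T.card ≠ A.card → p T = 0 := by
    intro T hT
    rw [PMF.apply_eq_zero_iff, PMF.support_map]
    rintro ⟨π, -, rfl⟩
    simp at hT
  split_ifs with hT
  · have hone : ∑ S ∈ Finset.powersetCard A.card Finset.univ, p S = 1 := by
      rw [← p.tsum_coe, tsum_fintype]
      refine Finset.sum_subset (Finset.subset_univ _) fun S _ hS => hsupp S ?_
      simpa [Finset.mem_powersetCard] using hS
    have hconst : ∀ S ∈ Finset.powersetCard A.card Finset.univ, p S = p T := by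
      intro S hS
      obtain ⟨σ, rfl⟩ := exists_perm_map_eq (hT.trans (Finset.mem_powersetCard.1 hS).2.symm)
      exact hinv σ T
    rw [Finset.sum_congr rfl hconst, Finset.sum_const, Finset.card_powersetCard,
      Finset.card_univ, Fintype.card_fin, nsmul_eq_mul, mul_comm] at hone
    exact ENNReal.eq_inv_of_mul_eq_one_left hone
  · exact hsupp T hT

end Distributions

section RandomSubsets

variable {ι : Type*} [DecidableEq ι]

/-- The random subset of `A` in which a subset `S` has probability proportional to `x ^ #S`. -/
noncomputable def subsetPMF (x : ℝ≥0∞) (hx : x ≠ ∞) (A : Finset ι) : PMF (Finset ι) :=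
  PMF.ofFinset (fun S => if S ⊆ A then x ^ S.card * ((1 + x) ^ A.card)⁻¹ else 0) A.powerset
    (by
      rw [Finset.sum_congr rfl fun S hS => if_pos (Finset.mem_powerset.1 hS), ← Finset.sum_mul]
      have := Finset.sum_pow_mul_eq_add_pow x 1 A
      simp only [one_pow, mul_one] at this
      rw [this, add_comm x 1]
      refine ENNReal.mul_inv_cancel ?_ ?_
      · exact pow_ne_zero _ (by simp)
      · exact ENNReal.pow_ne_top (by simp [hx]))
    (by
      intro S hS
      rw [if_neg (by simpa using hS)])

variable {x : ℝ≥0∞} {hx : x ≠ ∞}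

lemma subsetPMF_apply (A S : Finset ι) : subsetPMF x hx A S =
    if S ⊆ A then x ^ S.card * ((1 + x) ^ A.card)⁻¹ else 0 := rfl

lemma subset_of_mem_support_subsetPMF {A S : Finset ι} (h : S ∈ (subsetPMF x hx A).support) :
    S ⊆ A := by
  by_contra hS
  exact (PMF.mem_support_iff _ _).1 h (by rw [subsetPMF_apply, if_neg hS])

/-- Random subsets of disjoint sets unite to a random subset of their union. -/
lemma subsetPMF_bind_union {A B : Finset ι} (hAB : Disjoint A B) :
    ((subsetPMF x hx A).bind fun v => (subsetPMF x hx B).map fun T => v ∪ T) =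
      subsetPMF x hx (A ∪ B) := by
  ext S
  have hsplit : ∀ v ⊆ A, ∀ T ⊆ B, S = v ∪ T → v = S ∩ A ∧ T = S ∩ B := by
    rintro v hv T hT rfl
    have h1 : Disjoint v B := hAB.mono_left hv
    have h2 : Disjoint T A := hAB.symm.mono_left hT
    rw [Finset.union_inter_distrib_right, Finset.union_inter_distrib_right,
      Finset.inter_eq_left.2 hv, Finset.inter_eq_left.2 hT, Finset.disjoint_iff_inter_eq_empty.1 h1,
      Finset.disjoint_iff_inter_eq_empty.1 h2]
    simp
  have hzero : ∀ v T, (v ≠ S ∩ A ∨ T ≠ S ∩ B) →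
      subsetPMF x hx A v * (subsetPMF x hx B T * if S = v ∪ T then 1 else 0) = 0 := by
    intro v T hne
    by_cases hv : v ⊆ A
    · by_cases hT : T ⊆ B
      · rw [if_neg, mul_zero, mul_zero]
        intro hS
        have := hsplit v hv T hT hS
        tauto
      · rw [subsetPMF_apply B, if_neg hT, zero_mul, mul_zero]
    · rw [subsetPMF_apply A, if_neg hv, zero_mul]
  have hterm : ∀ v, subsetPMF x hx A v * (subsetPMF x hx B).map (fun T => v ∪ T) S =
      ∑' T, subsetPMF x hx A v * (subsetPMF x hx B T * if S = v ∪ T then 1 else 0) := by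
    intro v
    rw [PMF.map_apply, ← ENNReal.tsum_mul_left]
    simp only [mul_ite, mul_one, mul_zero]
  rw [PMF.bind_apply]
  simp_rw [hterm]
  rw [tsum_eq_single (S ∩ A), tsum_eq_single (S ∩ B)]
  · rw [subsetPMF_apply, subsetPMF_apply, subsetPMF_apply, if_pos Finset.inter_subset_right,
      if_pos Finset.inter_subset_right, ← Finset.inter_union_distrib_left]
    by_cases hS : S ⊆ A ∪ B
    · rw [if_pos (Finset.inter_eq_left.2 hS).symm, if_pos hS, mul_one, mul_mul_mul_comm, ← pow_add,
        ← Finset.card_union_of_disjoint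
          (hAB.mono Finset.inter_subset_right Finset.inter_subset_right),
        ← Finset.inter_union_distrib_left, Finset.inter_eq_left.2 hS,
        Finset.card_union_of_disjoint hAB, pow_add, ENNReal.mul_inv]
      · left
        exact pow_ne_zero _ (by simp)
      · left
        exact ENNReal.pow_ne_top (by simp [hx])
    · rw [if_neg fun h => hS (Finset.inter_eq_left.1 h.symm), if_neg hS, mul_zero, mul_zero]
  · intro T hT
    exact hzero _ _ (Or.inr hT)
  · intro v hv
    exact ENNReal.tsum_eq_zero.2 fun T => hzero v T (Or.inl hv)

lemma subsetPMF_map_embedding {κ : Type*} [Fintype κ] [DecidableEq κ] (e : κ ↪ ι) :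
    (subsetPMF x hx (Finset.univ : Finset κ)).map (fun T => T.map e) =
      subsetPMF x hx (Finset.univ.map e) := by
  ext S
  rw [PMF.map_apply, subsetPMF_apply]
  split_ifs with hS
  · obtain ⟨T, -, rfl⟩ := Finset.subset_map_iff.1 hS
    rw [tsum_eq_single T]
    · simp [subsetPMF_apply]
    · intro T' hT'
      rw [if_neg]
      simpa using hT'.symm
  · refine ENNReal.tsum_eq_zero.2 fun T => if_neg ?_
    rintro rfl
    exact hS (Finset.map_subset_map.2 (Finset.subset_univ _))

end RandomSubsets

section Rows

/-- The interval of length `s + 1` that ends at `i`. -/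
def run {D : ℕ} (i s : Fin D) : Finset (Fin D) :=
  Finset.univ.filter fun j => i.1 ≤ j.1 + s.1 ∧ j ≤ i

lemma card_run {D : ℕ} {i s : Fin D} (h : s ≤ i) : (run i s).card = s + 1 := by
  have himg : (run i s).map Fin.valEmbedding = Finset.Icc (i.1 - s.1) i.1 := by
    ext a
    simp only [run, Finset.mem_map, Finset.mem_filter, Finset.mem_univ, true_and,
      Fin.valEmbedding_apply, Finset.mem_Icc]
    constructor
    · rintro ⟨j, ⟨h1, h2⟩, rfl⟩
      have : j.1 ≤ i.1 := h2
      omega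
    · rintro ⟨h1, h2⟩
      refine ⟨⟨a, by omega⟩, ⟨?_, h2⟩, rfl⟩
      show i.1 ≤ a + s.1
      omega
  have hs : s.1 ≤ i.1 := h
  rw [← Finset.card_map Fin.valEmbedding, himg, Nat.card_Icc]
  omega

/-- The sets that are added to the interference: the empty set and the permuted runs. -/
def rows {D : ℕ} (π : Equiv.Perm (Fin D)) (l : Fin D → Fin D) : Fin (D + 1) → Finset (Fin D) :=
  Fin.cons ∅ fun i => (run i (l i)).map π.toEmbedding

/-- The permuted runs are a triangular basis. -/
lemma mem_span_rows {R M : Type*} [Ring R] [AddCommGroup M] [Module R M] {D : ℕ}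
    (π : Equiv.Perm (Fin D)) (l : Fin D → Fin D) (b : Fin D → M) (i : Fin D) :
    b i ∈ Submodule.span R (Set.range fun j => ∑ k ∈ rows π l j, b k) := by
  suffices h : ∀ i, b (π i) ∈ Submodule.span R (Set.range fun j => ∑ k ∈ rows π l j, b k) by
    simpa using h (π.symm i)
  intro i
  induction i using WellFoundedLT.induction with
  | ind i ih =>
  have hi : i ∈ run i (l i) := by simp [run]
  have hrow : ∑ k ∈ run i (l i), b (π k) ∈
      Submodule.span R (Set.range fun j => ∑ k ∈ rows π l j, b k) := by
    refine Submodule.subset_span ⟨i.succ, ?_⟩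
    simp [rows]
  rw [← Finset.add_sum_erase _ _ hi] at hrow
  refine (Submodule.add_mem_iff_left _ (Submodule.sum_mem _ fun k hk => ih k ?_)).1 hrow
  rw [Finset.mem_erase, run, Finset.mem_filter] at hk
  exact lt_of_le_of_ne hk.2.2.2 hk.1

/-- Random sets, one of which is empty and which together determine all coordinates, while each of
them has the distribution `subsetPMF`. -/
lemma exists_random_rows {D : ℕ} {x : ℝ} (hx : 0 ≤ x) (hxD : (1 + x) ^ D = D + 1) :
    ∃ R : PMF (Fin (D + 1) → Finset (Fin D)),
      (∀ r ∈ R.support, ∃ π l k, r = fun n => rows π l (n + k)) ∧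
      ∀ n, R.map (fun r => r n) =
        subsetPMF (ENNReal.ofReal x) ENNReal.ofReal_ne_top Finset.univ := by
  obtain ⟨μ, hμ0, hμ⟩ := exists_triangular_stochastic hx hxD
  obtain ⟨ν, hν⟩ := exists_coupling μ
  let U := PMF.uniformOfFintype (Equiv.Perm (Fin D))
  let R : PMF (Fin (D + 1) → Finset (Fin D)) :=
    (PMF.uniformOfFintype (Fin (D + 1))).bind fun k => U.bind fun π => ν.map fun l n =>
      rows π l (n + k)
  let q : Fin (D + 1) → PMF (Finset (Fin D)) := fun j =>
    U.bind fun π => ν.map fun l => rows π l j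
  have hq0 : q 0 = PMF.pure ∅ := by
    simp only [q, rows, Fin.cons_zero]
    exact (congrArg _ (funext fun _ => PMF.map_const _ _)).trans (PMF.bind_const _ _)
  have hqs : ∀ i : Fin D, q i.succ = (μ i).bind fun s =>
      U.map fun π => (run i s).map π.toEmbedding := by
    intro i
    simp only [q, rows, Fin.cons_succ, ← hν i, PMF.bind_map]
    simp only [PMF.map, PMF.bind_comm U ν, Function.comp_def]
  have hsum : ∀ T, ∑ j, q j T = ENNReal.ofReal x ^ T.card := by
    intro T
    have hs : ∀ i, q (Fin.succ i) T =
        ∑ s : Fin D, if T.card = s.1 + 1 then μ i s * (D.choose (s + 1) : ℝ≥0∞)⁻¹ else 0 := by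
      intro i
      rw [hqs, PMF.bind_apply, tsum_fintype]
      refine Finset.sum_congr rfl fun s _ => ?_
      rcases lt_or_ge i s with h | h
      · simp [hμ0 i s h]
      · rw [map_uniform_perm_apply, card_run h]
        simp
    rw [Fin.sum_univ_succ, hq0, Finset.sum_congr rfl fun i _ => hs i, Finset.sum_comm]
    rcases Nat.eq_zero_or_pos T.card with h | h
    · simp only [h, (Nat.succ_ne_zero _).symm, if_false]
      simp [Finset.card_eq_zero.1 h]
    · have hT : T ≠ ∅ := Finset.card_pos.1 h |>.ne_empty
      have hTD : T.card ≤ D := by simpa using Finset.card_le_univ T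
      rw [PMF.pure_apply, if_neg hT, zero_add,
        Finset.sum_eq_single (⟨T.card - 1, by omega⟩ : Fin D)]
      · have h1 : T.card - 1 + 1 = T.card := by omega
        have h2 := hμ ⟨T.card - 1, by omega⟩
        simp only [h1] at h2
        simp only [h1, if_true]
        rw [← Finset.sum_mul, h2, mul_right_comm, ENNReal.mul_inv_cancel, one_mul]
        · exact_mod_cast (Nat.choose_pos hTD).ne'
        · simp
      · intro s _ hs
        refine Finset.sum_eq_zero fun i _ => if_neg fun h' => hs ?_
        ext
        simp [h']
      · simp
  refine ⟨R, ?_, fun n => ?_⟩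
  · intro r hr
    simp only [R, PMF.mem_support_bind_iff, PMF.support_map, Set.mem_image] at hr
    obtain ⟨k, -, π, -, l, -, rfl⟩ := hr
    exact ⟨π, l, k, rfl⟩
  · have hRn : R.map (fun r => r n) =
        (PMF.uniformOfFintype (Fin (D + 1))).bind fun k => q (n + k) := by
      simp only [R, q, PMF.map_bind, PMF.map_comp, Function.comp_def]
    ext T
    rw [hRn, PMF.bind_apply, tsum_fintype]
    simp only [PMF.uniformOfFintype_apply]
    have hshift : ∑ k, q (n + k) T = ∑ j, q j T :=
      Equiv.sum_comp (Equiv.addLeft n) (fun j => q j T)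
    rw [← Finset.mul_sum, hshift, hsum,
      subsetPMF_apply, if_pos (Finset.subset_univ _), mul_comm]
    congr 2
    rw [Finset.card_univ, Fintype.card_fin, Fintype.card_fin, ← ENNReal.ofReal_one,
      ← ENNReal.ofReal_add zero_le_one hx, ← ENNReal.ofReal_pow (by linarith), hxD]
    rw [ENNReal.ofReal_add (by positivity) zero_le_one]
    simp

end Rows

section Protocol

variable {F : Type*} [Field F] {m N K D : ℕ} {hDK : D ≤ K}

/-- Messages whose unit vectors are in the span of the queries can be decoded. -/
lemma exists_decode (W : Demand K D) (s : Set (Fin N → Query F K))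
    (h : ∀ Q ∈ s, ∀ i ∈ W.1, Pi.single i 1 ∈ ⨆ n, querySpan (Q n)) :
    ∃ decode : (Fin N → List (Fin m → F)) → (Fin N → Query F K) → (W.1 → Fin m → F),
      ∀ Q ∈ s, ∀ X : Messages F m K,
        decode (fun n => answer (Q n) X) Q = fun i => X i.1 := by
  classical
  refine ⟨fun A Q => if h : ∃ X : Messages F m K, (fun n => answer (Q n) X) = A then
    fun i => h.choose i.1 else 0, fun Q hQ X => ?_⟩
  have hex : ∃ Y : Messages F m K, (fun n => answer (Q n) Y) = fun n => answer (Q n) X :=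
    ⟨X, rfl⟩
  beta_reduce
  rw [dif_pos hex]
  ext1 i
  have := combination_eq_of_mem_span (fun n => congrFun hex.choose_spec n) (h Q hQ i i.2)
  rwa [combination_single, combination_single] at this

/-- The 0/1-vector of a set of messages. -/
def indicatorVector (F : Type*) [Field F] {K : ℕ} (S : Finset (Fin K)) : Fin K → F :=
  ∑ i ∈ S, Pi.single i 1

lemma indicatorVector_eq_zero_iff {S : Finset (Fin K)} : indicatorVector F S = 0 ↔ S = ∅ := by
  constructor
  · intro h
    refine Finset.eq_empty_of_forall_notMem fun i hi => ?_
    have := congrFun h i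
    simp [indicatorVector, Finset.sum_apply, Pi.single_apply, hi] at this
  · rintro rfl
    simp [indicatorVector]

/-- The increasing enumeration of a demand index set. -/
def demandEmb (W : Demand K D) : Fin D ↪ Fin K := (W.1.orderEmbOfFin W.2).toEmbedding

lemma map_demandEmb_univ (W : Demand K D) : Finset.univ.map (demandEmb W) = W.1 := by
  simp [demandEmb]

/-- The query tuple with interference `v` and demanded parts `r`. -/
def queryTuple (F : Type*) [Field F] (W : Demand K D) (v : Finset (Fin K))
    (r : Fin N → Finset (Fin D)) : Fin N → Query F K :=
  fun n => [indicatorVector F (v ∪ (r n).map (demandEmb W))]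

lemma single_mem_iSup_queryTuple {W : Demand K D} {v : Finset (Fin K)} (hv : v ⊆ W.1ᶜ)
    {r : Fin (D + 1) → Finset (Fin D)} (hr : ∃ π l k, r = fun n => rows π l (n + k))
    {i : Fin K} (hi : i ∈ W.1) :
    Pi.single i 1 ∈ ⨆ n, querySpan (queryTuple F W v r n) := by
  obtain ⟨π, l, k, rfl⟩ := hr
  rw [← map_demandEmb_univ W, Finset.mem_map] at hi
  obtain ⟨a, -, rfl⟩ := hi
  set V := ⨆ n, querySpan (queryTuple F W v (fun n => rows π l (n + k)) n)
  have hmem : ∀ j, indicatorVector F (v ∪ (rows π l j).map (demandEmb W)) ∈ V := by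
    intro j
    refine Submodule.mem_iSup_of_mem (j - k) (Submodule.subset_span ?_)
    simp [queryTuple]
  have hsplit : ∀ j, indicatorVector F (v ∪ (rows π l j).map (demandEmb W)) =
      indicatorVector F v + ∑ t ∈ rows π l j, Pi.single (demandEmb W t) 1 := by
    intro j
    rw [indicatorVector, Finset.sum_union, Finset.sum_map, indicatorVector]
    refine (Finset.subset_compl_iff_disjoint_right.1 hv).mono_right ?_
    rw [← map_demandEmb_univ W]
    exact Finset.map_subset_map.2 (Finset.subset_univ _)
  have hv0 : indicatorVector F v ∈ V := by
    simpa [rows] using hmem 0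
  refine Submodule.span_le.2 ?_ (mem_span_rows (R := F) π l
    (fun t => (Pi.single (demandEmb W t) 1 : Fin K → F)) a)
  rintro _ ⟨j, rfl⟩
  have := hmem j
  rw [hsplit] at this
  exact (Submodule.add_mem_iff_right _ hv0).1 this

/-- A protocol in which each server is asked for the sum over a random subset of the messages. -/
lemma exists_protocol (F : Type*) [Field F] (m : ℕ) (hDK : D ≤ K) {x : ℝ} (hx : 0 ≤ x)
    (hxD : (1 + x) ^ D = D + 1) :
    ∃ P : LinearProtocol F m (D + 1) K D hDK, ∀ n, queryMarginal hDK P.query n =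
      (subsetPMF (ENNReal.ofReal x) ENNReal.ofReal_ne_top Finset.univ).map
        fun S => [indicatorVector F S] := by
  obtain ⟨R, hR, hRn⟩ := exists_random_rows hx hxD
  let query : Demand K D → PMF (Fin (D + 1) → Query F K) := fun W =>
    (subsetPMF (ENNReal.ofReal x) ENNReal.ofReal_ne_top W.1ᶜ).bind fun v =>
      R.map fun r => queryTuple F W v r
  have hmarg : ∀ n W, (query W).map (fun Q => Q n) =
      (subsetPMF (ENNReal.ofReal x) ENNReal.ofReal_ne_top Finset.univ).map
        fun S => [indicatorVector F S] := by
    intro n W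
    have hW : W.1ᶜ ∪ W.1 = Finset.univ := by
      rw [Finset.union_comm, Finset.union_compl]
    rw [← hW, ← subsetPMF_bind_union disjoint_compl_left, ← map_demandEmb_univ W,
      ← subsetPMF_map_embedding, ← hRn n]
    simp only [query, PMF.map_bind, PMF.map_comp, Function.comp_def, queryTuple,
      map_demandEmb_univ]
  refine ⟨⟨query, condProb_eq_of_map_query_eq hmarg, fun W => exists_decode W _ ?_⟩,
    fun n => ?_⟩
  · intro Q hQ i hi
    simp only [query, PMF.mem_support_bind_iff, PMF.support_map, Set.mem_image] at hQ
    obtain ⟨v, hv, r, hr, rfl⟩ := hQ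
    exact single_mem_iSup_queryTuple (subset_of_mem_support_subsetPMF hv) (hR r hr) hi
  · simp [queryMarginal_eq_bind, hmarg]

lemma downloadBits_indicatorVector (S : Finset (Fin K)) :
    downloadBits m [indicatorVector F S] = if S = ∅ then 0 else messageBits F m := by
  split_ifs with h
  · simp [downloadBits, indicatorVector_eq_zero_iff.2 h]
  · simp [downloadBits, indicatorVector_eq_zero_iff.not.2 h]

lemma expectedDownload_of_queryMarginal {x : ℝ≥0∞} {hx : x ≠ ∞}
    {P : LinearProtocol F m N K D hDK}
    (hP : ∀ n, queryMarginal hDK P.query n =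
      (subsetPMF x hx Finset.univ).map fun S => [indicatorVector F S]) :
    P.expectedDownload =
      N * ((1 - ((1 + x) ^ K)⁻¹) * ENNReal.ofReal (messageBits F m)) := by
  have hzero : subsetPMF x hx (Finset.univ : Finset (Fin K)) ∅ = ((1 + x) ^ K)⁻¹ := by
    simp [subsetPMF_apply]
  have hone : ∑ S ∈ Finset.univ.erase ∅, subsetPMF x hx (Finset.univ : Finset (Fin K)) S =
      1 - ((1 + x) ^ K)⁻¹ := by
    rw [← hzero, ← sum_coe (subsetPMF x hx (Finset.univ : Finset (Fin K))),
      ← Finset.add_sum_erase _ _ (Finset.mem_univ ∅),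
      ENNReal.add_sub_cancel_left (PMF.apply_ne_top _ _)]
  have hserver : ∀ n, ∑' c, queryMarginal hDK P.query n c * ENNReal.ofReal (downloadBits m c) =
      (1 - ((1 + x) ^ K)⁻¹) * ENNReal.ofReal (messageBits F m) := by
    intro n
    rw [hP, tsum_map_mul, tsum_fintype, ← Finset.add_sum_erase _ _ (Finset.mem_univ ∅), ← hone,
      Finset.sum_mul]
    simp only [downloadBits_indicatorVector, if_true, ENNReal.ofReal_zero, mul_zero, zero_add]
    refine Finset.sum_congr rfl fun S hS => ?_
    rw [if_neg (Finset.ne_of_mem_erase hS)]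
  simp [P.expectedDownload_eq, hserver]

lemma messageBits_pos (F : Type*) [Field F] [Finite F] (hm : 1 ≤ m) : 0 < messageBits F m := by
  refine mul_pos (by exact_mod_cast hm) (Real.logb_pos one_lt_two ?_)
  exact_mod_cast Finite.one_lt_card

end Protocol

section Capacity

variable {F : Type*} [Field F] [Finite F] {m K D : ℕ} {hDK : D ≤ K}

lemma rate_le (hm : 1 ≤ m) (hD : 1 < D) (hdvd : D ∣ K)
    (P : LinearProtocol F m (D + 1) K D hDK) :
    P.rate ≤ ENNReal.ofReal
      ((1 - 1 / ((D + 1 : ℕ) : ℝ)) / (1 - 1 / ((D + 1 : ℕ) : ℝ) ^ (K / D))) := by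
  have hB := messageBits_pos F hm
  have hL : 0 < K / D := Nat.div_pos hDK (by omega)
  have hN : (1 : ℝ) < ((D + 1 : ℕ) : ℝ) := by exact_mod_cast (by omega : 1 < D + 1)
  set L := K / D
  set N : ℝ := ((D + 1 : ℕ) : ℝ)
  have hlow : ENNReal.ofReal (D * (∑ k ∈ Finset.range L, N⁻¹ ^ k) * messageBits F m) ≤
      P.expectedDownload := by
    refine le_trans (le_of_eq ?_) ((mul_le_mul_left (P.geom_le_expectedRank hm L ∅ (by
      simpa using Nat.mul_div_cancel' hdvd)) _).trans P.expectedRank_mul_le)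
    rw [ENNReal.ofReal_mul (by positivity), ENNReal.ofReal_mul (by positivity),
      ENNReal.ofReal_sum_of_nonneg fun _ _ => by positivity, ENNReal.ofReal_natCast]
    simp_rw [ENNReal.ofReal_pow (inv_nonneg.2 (zero_le_one.trans hN.le)),
      ENNReal.ofReal_inv_of_pos (zero_lt_one.trans hN), N, ENNReal.ofReal_natCast]
  have hgeom : (∑ k ∈ Finset.range L, N⁻¹ ^ k) = (1 - 1 / N ^ L) / (1 - 1 / N) := by
    have h1 : N⁻¹ ≠ 1 := inv_ne_one.2 hN.ne'
    rw [geom_sum_eq h1, ← neg_div_neg_eq]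
    simp
  have hpow : 1 / N ^ L < 1 := by
    rw [div_lt_one (by positivity)]
    exact one_lt_pow₀ hN hL.ne'
  have hinv : 1 / N < 1 := by
    rw [div_lt_one (by positivity)]
    exact hN
  have hD0 : (0 : ℝ) < D := by exact_mod_cast (by omega : 0 < D)
  have h1 : 0 < 1 - 1 / N ^ L := by linarith
  have h2 : 0 < 1 - 1 / N := by linarith
  rw [hgeom] at hlow
  have hpos : 0 < D * ((1 - 1 / N ^ L) / (1 - 1 / N)) * messageBits F m := by positivity
  calc P.rate ≤ ENNReal.ofReal (D * messageBits F m) /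
        ENNReal.ofReal (D * ((1 - 1 / N ^ L) / (1 - 1 / N)) * messageBits F m) :=
        ENNReal.div_le_div_left hlow _
    _ = _ := by
        rw [← ENNReal.ofReal_div_of_pos hpos]
        congr 1
        field_simp

lemma exists_rate_eq (F : Type*) [Field F] [Finite F] {m : ℕ} (hm : 1 ≤ m) (hD : 1 < D)
    (hDK : D ≤ K) (hdvd : D ∣ K) :
    ∃ P : LinearProtocol F m (D + 1) K D hDK, P.rate =
      ENNReal.ofReal ((1 - 1 / ((D + 1 : ℕ) : ℝ)) / (1 - 1 / ((D + 1 : ℕ) : ℝ) ^ (K / D))) := by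
  obtain ⟨x, hx, hxD⟩ := exists_root (by omega : D ≠ 0)
  obtain ⟨P, hP⟩ := exists_protocol F m hDK hx hxD
  refine ⟨P, ?_⟩
  have hB := messageBits_pos F hm
  have hL : 0 < K / D := Nat.div_pos hDK (by omega)
  have hK : D * (K / D) = K := Nat.mul_div_cancel' hdvd
  set L := K / D
  have hN : (1 : ℝ) < ((D + 1 : ℕ) : ℝ) := by exact_mod_cast (by omega : 1 < D + 1)
  have hDN : (D : ℝ) = ((D + 1 : ℕ) : ℝ) - 1 := by simp
  have hxK : (1 + x) ^ K = ((D + 1 : ℕ) : ℝ) ^ L := by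
    rw [← hK, pow_mul, hxD]
    push_cast
    rfl
  have hNN : (((D + 1 : ℕ) : ℝ≥0∞)) = ENNReal.ofReal ((D + 1 : ℕ) : ℝ) :=
    (ENNReal.ofReal_natCast _).symm
  rw [LinearProtocol.rate, expectedDownload_of_queryMarginal hP, hNN, hDN]
  set N : ℝ := ((D + 1 : ℕ) : ℝ)
  have hpow : 1 / N ^ L < 1 := by
    rw [div_lt_one (by positivity)]
    exact one_lt_pow₀ hN hL.ne'
  have h1 : 0 < 1 - 1 / N ^ L := by linarith
  have hfac : 1 - ((1 + ENNReal.ofReal x) ^ K)⁻¹ = ENNReal.ofReal (1 - 1 / N ^ L) := by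
    rw [← ENNReal.ofReal_one, ← ENNReal.ofReal_add zero_le_one hx,
      ← ENNReal.ofReal_pow (by linarith), hxK, ← ENNReal.ofReal_inv_of_pos (by positivity),
      ← ENNReal.ofReal_sub _ (by positivity), one_div]
  have hpos : 0 < N * ((1 - 1 / N ^ L) * messageBits F m) := by positivity
  rw [hfac, ← ENNReal.ofReal_mul h1.le, ← ENNReal.ofReal_mul (by positivity),
    ← ENNReal.ofReal_div_of_pos hpos]
  congr 1
  field_simp

end Capacity

end MPIR

theorem theorem2 (F : Type*) [Field F] [Finite F] (m N K D : ℕ) (hm : 1 ≤ m)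
    (hD : 1 < D) (hDK : D ≤ K) (hdvd : D ∣ K) (hN : N = D + 1) :
    MPIR.linearCapacity F m N K D hDK =
      ENNReal.ofReal ((1 - 1 / (N : ℝ)) / (1 - 1 / (N : ℝ) ^ (K / D))) := by
  subst hN
  obtain ⟨P, hP⟩ := MPIR.exists_rate_eq F hm hD hDK hdvd
  exact le_antisymm (iSup_le fun P => MPIR.rate_le hm hD hdvd P)
    (hP ▸ le_iSup (fun P => MPIR.LinearProtocol.rate P) P)
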